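/- Let $\omega \in S_n$ be vexillary, i.e. $2143$-avoiding. Let $r_i$ be the minimum number of entries that must be removed from $\omega(i), \omega(i+1), \ldots, \omega(n)$ to leave an increasing sequence beginning with $\omega(i)$ (Rajchgot code), and let $c_i = |\{j : i<j,\ \omega(i)>\omega(j)\}|$ (Lehmer code). For $i \in [n]$ let $\mathrm{rank}_\omega(i)$ be the length of a longest increasing subsequence of $\omega$ all of whose positions $j$ satisfy $j \le \omega^{-1}(i)$ and $\omega(j) \le i$. Let $P_R(\omega)$ be the Rothe bumpless pipe dream of $\omega$, i.e. the unique bumpless pipe dream of size $n \times n$ that has a down-elbow (joining the bottom and right edges of its square) in each square $(i,\omega(i))$ and has no up-elbows (joining the left and top edges). Label each blank tile $(i,j)$ of $P_R(\omega)$ with $r(i,j) = |\{k : k<i,\ \omega(k)<j\}|$. Then there is a unique Young diagram $\lambda(\omega)$ having, on each northwest-southeast diagonal $\{(i,j): j-i=d\}$, $d \in \mathbb{Z}$, the same number of tiles as there are blank tiles of $P_R(\omega)$ on that diagonal. Fill the $m$-th tile of $\lambda(\omega)$ on each diagonal (counted from the northwest) with the label of the $m$-th blank tile of $P_R(\omega)$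 on the same diagonal, and let $\tau_k(\omega)$ be the set of tiles of $\lambda(\omega)$ filled with values $\ge k$. For a finite set $S$ of squares let $\rho_a(S)$ be the maximal length $l$ of an antidiagonal path in $S$, i.e. of a subset $\{(i_1,j_1),\ldots,(i_l,j_l)\} \subseteq S$ with $i_1>\cdots>i_l$ and $j_1<\cdots<j_l$. Then for every integer $k \ge 1$, $$\sum_{\{i\,:\,\mathrm{rank}_\omega(i)=k\}} \bigl(r_{\omega^{-1}(i)} - c_{\omega^{-1}(i)}\bigr) = \rho_a(\tau_k(\omega)).$$ -/

import Mathlib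

namespace Vexillary

/-- Permutations of `[n]` are elements of `Equiv.Perm (Fin n)`; rows, columns, positions and values
are numbered from `0`. A permutation is vexillary if it avoids the pattern `2143`. -/
def IsVexillary {n : ℕ} (w : Equiv.Perm (Fin n)) : Prop :=
  ¬ ∃ a b c d : Fin n, a < b ∧ b < c ∧ c < d ∧ w b < w a ∧ w a < w d ∧ w d < w c

/-! ### Bumpless pipe dreams -/

/-- The six tiles of a bumpless pipe dream. An up-elbow joins the left and the top edge of its
square, a down-elbow joins the bottom and the right edge. -/
inductive Tile : Type
  | cross
  | vertical
  | horizontal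
  | upElbow
  | downElbow
  | blank
  deriving DecidableEq

namespace Tile

/-- The tile has a pipe through its top edge. -/
def top : Tile → Bool
  | cross => true
  | vertical => true
  | upElbow => true
  | _ => false

/-- The tile has a pipe through its bottom edge. -/
def bottom : Tile → Bool
  | cross => true
  | vertical => true
  | downElbow => true
  | _ => false

/-- The tile has a pipe through its left edge. -/
def left : Tile → Bool
  | cross => true
  | horizontal => true
  | upElbow => true
  | _ => false

/-- The tile has a pipe through its right edge. -/
def right : Tile → Bool
  | cross => true
  | horizontal => true
  | downElbow => true
  | _ => false

end Tile

/-- A tiling of the `n × n` grid (`P i j` is the tile in row `i`, counted from the top, and column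
`j`) is a bumpless pipe dream if adjacent tiles fit together, a pipe enters at every bottom edge of
the grid and leaves at every right edge, and none meets the top or the left side of the grid. -/
structure IsBPD {n : ℕ} (P : Fin n → Fin n → Tile) : Prop where
  vert : ∀ i i' j : Fin n, (i' : ℕ) = i + 1 → (P i j).bottom = (P i' j).top
  horiz : ∀ i j j' : Fin n, (j' : ℕ) = j + 1 → (P i j).right = (P i j').left
  top_side : ∀ i j : Fin n, (i : ℕ) = 0 → (P i j).top = false
  left_side : ∀ i j : Fin n, (j : ℕ) = 0 → (P i j).left = false
  bottom_side : ∀ i j : Fin n, (i : ℕ) + 1 = n → (P i j).bottom = true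
  right_side : ∀ i j : Fin n, (j : ℕ) + 1 = n → (P i j).right = true

/-- The Rothe bumpless pipe dream `P_R(w)`: in each row `i` there is a down-elbow in column `w i`,
with a pipe running to the right and down from it. See `rotheBPD_spec` for its characterization. -/
def rotheBPD {n : ℕ} (w : Equiv.Perm (Fin n)) (i j : Fin n) : Tile :=
  if w i = j then Tile.downElbow
  else if w i < j then (if w.symm j < i then Tile.cross else Tile.horizontal)
  else (if w.symm j < i then Tile.vertical else Tile.blank)

theorem rotheBPD_left {n : ℕ} (w : Equiv.Perm (Fin n)) (i j : Fin n) :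
    (rotheBPD w i j).left = decide (w i < j) := by
  unfold rotheBPD
  by_cases h : w i = j
  · simp [h, Tile.left]
  · by_cases h1 : w i < j <;> by_cases h2 : w.symm j < i <;> simp [h, h1, h2, Tile.left]

theorem rotheBPD_right {n : ℕ} (w : Equiv.Perm (Fin n)) (i j : Fin n) :
    (rotheBPD w i j).right = decide (w i ≤ j) := by
  unfold rotheBPD
  by_cases h : w i = j
  · simp [h, Tile.right]
  · by_cases h1 : w i < j <;> by_cases h2 : w.symm j < i <;>
      simp [h, h1, h2, Tile.right, le_iff_lt_or_eq]

theorem rotheBPD_top {n : ℕ} (w : Equiv.Perm (Fin n)) (i j : Fin n) :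
    (rotheBPD w i j).top = decide (w.symm j < i) := by
  unfold rotheBPD
  by_cases h : w i = j
  · subst h; simp [Tile.top]
  · by_cases h1 : w i < j <;> by_cases h2 : w.symm j < i <;> simp [h, h1, h2, Tile.top]

theorem rotheBPD_bottom {n : ℕ} (w : Equiv.Perm (Fin n)) (i j : Fin n) :
    (rotheBPD w i j).bottom = decide (w.symm j ≤ i) := by
  unfold rotheBPD
  by_cases h : w i = j
  · subst h; simp [Tile.bottom]
  · have h' : w.symm j ≠ i := fun e => h (by rw [← e]; simp)
    by_cases h1 : w i < j <;> by_cases h2 : w.symm j < i <;>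
      simp [h, h', h1, h2, Tile.bottom, le_iff_lt_or_eq]

/-- `rotheBPD w` is the unique bumpless pipe dream with down-elbows in all squares `(i, w i)` and
without up-elbows. -/
theorem rotheBPD_spec {n : ℕ} (w : Equiv.Perm (Fin n)) (P : Fin n → Fin n → Tile) :
    (IsBPD P ∧ (∀ i, P i (w i) = Tile.downElbow) ∧ ∀ i j, P i j ≠ Tile.upElbow) ↔
      P = rotheBPD w := by
  constructor
  · rintro ⟨hP, hd, hu⟩
    have hrow : ∀ (i j : Fin n) (m : ℕ) (j' : Fin n), (j' : ℕ) = j + 1 + m →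
        (P i j).right = true → (P i j').left = true := by
      intro i j m
      induction m with
      | zero => intro j' h hr; rw [← hP.horiz i j j' (by simpa using h)]; exact hr
      | succ m ih =>
        intro j' h hr
        have hlt : (j : ℕ) + 1 + m < n := by have := j'.isLt; omega
        have h1 := ih ⟨j + 1 + m, hlt⟩ rfl hr
        rw [← hP.horiz i ⟨j + 1 + m, hlt⟩ j' (by simp; omega)]
        have h2 := hu i ⟨j + 1 + m, hlt⟩
        revert h1 h2
        cases P i ⟨j + 1 + m, hlt⟩ <;> simp [Tile.left, Tile.right]
    have hcol : ∀ (i j : Fin n) (m : ℕ) (i' : Fin n), (i' : ℕ) = i + 1 + m →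
        (P i j).bottom = true → (P i' j).top = true := by
      intro i j m
      induction m with
      | zero => intro i' h hr; rw [← hP.vert i i' j (by simpa using h)]; exact hr
      | succ m ih =>
        intro i' h hr
        have hlt : (i : ℕ) + 1 + m < n := by have := i'.isLt; omega
        have h1 := ih ⟨i + 1 + m, hlt⟩ rfl hr
        rw [← hP.vert ⟨i + 1 + m, hlt⟩ i' j (by simp; omega)]
        have h2 := hu ⟨i + 1 + m, hlt⟩ j
        revert h1 h2
        cases P ⟨i + 1 + m, hlt⟩ j <;> simp [Tile.top, Tile.bottom]
    funext i j
    by_cases hij : w i = j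
    · subst hij; rw [hd]; simp [rotheBPD]
    have hij' : w.symm j ≠ i := fun e => hij (by rw [← e]; simp)
    have hu' := hu i j
    have hl : w i < j → (P i j).left = true := fun h =>
      hrow i (w i) (j - w i - 1) j (by have : (w i : ℕ) < j := h; omega)
        (by rw [hd]; rfl)
    have hr : ¬ w i < j → (P i j).right = false := by
      intro h
      have hlt : (j : ℕ) < w i := lt_of_le_of_ne (not_lt.1 h) (fun e => hij (Fin.ext e.symm))
      by_contra hc
      have := hrow i j (w i - j - 1) (w i) (by omega) (by simpa using hc)
      rw [hd] at this
      simp [Tile.left] at this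
    have hdj : P (w.symm j) j = Tile.downElbow := by simpa using hd (w.symm j)
    have ht : w.symm j < i → (P i j).top = true := fun h =>
      hcol (w.symm j) j (i - w.symm j - 1) i (by have : (w.symm j : ℕ) < i := h; omega)
        (by rw [hdj]; rfl)
    have hb : ¬ w.symm j < i → (P i j).bottom = false := by
      intro h
      have hlt : (i : ℕ) < w.symm j :=
        lt_of_le_of_ne (not_lt.1 h) (fun e => hij' (Fin.ext e.symm))
      by_contra hc
      have := hcol i j (w.symm j - i - 1) (w.symm j) (by omega) (by simpa using hc)
      rw [hdj] at this
      simp [Tile.top] at this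
    unfold rotheBPD
    by_cases h1 : w i < j <;> by_cases h2 : w.symm j < i <;>
      simp only [h1, h2, hij, if_true, if_false, not_true_eq_false, not_false_eq_true,
        forall_true_left, false_imp_iff] at hl hr ht hb ⊢ <;>
      revert hu' hl hr ht hb <;>
      cases P i j <;> simp [Tile.left, Tile.right, Tile.top, Tile.bottom]
  · rintro rfl
    refine ⟨⟨?_, ?_, ?_, ?_, ?_, ?_⟩, ?_, ?_⟩
    · intro i i' j h
      rw [rotheBPD_bottom, rotheBPD_top]
      congr 1
      simp only [Fin.le_def, Fin.lt_def, eq_iff_iff]; omega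
    · intro i j j' h
      rw [rotheBPD_right, rotheBPD_left]
      congr 1
      simp only [Fin.le_def, Fin.lt_def, eq_iff_iff]; omega
    · intro i j h
      rw [rotheBPD_top]; simp only [Fin.lt_def, decide_eq_false_iff_not]; omega
    · intro i j h
      rw [rotheBPD_left]; simp only [Fin.lt_def, decide_eq_false_iff_not]; omega
    · intro i j h
      rw [rotheBPD_bottom]; simp only [Fin.le_def, decide_eq_true_eq]
      have := (w.symm j).isLt; omega
    · intro i j h
      rw [rotheBPD_right]; simp only [Fin.le_def, decide_eq_true_eq]
      have := (w i).isLt; omega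
    · intro i; simp [rotheBPD]
    · intro i j
      unfold rotheBPD
      split_ifs <;> simp

/-- The set `D(P_R(w))` of blank tiles of the Rothe bumpless pipe dream, as pairs (row, column). -/
def blankTiles {n : ℕ} (w : Equiv.Perm (Fin n)) : Finset (ℕ × ℕ) :=
  (Finset.univ.filter fun p : Fin n × Fin n => rotheBPD w p.1 p.2 = Tile.blank).image
    fun p => ((p.1 : ℕ), (p.2 : ℕ))

/-- The label `r(i, j)`: the number of squares `(k, w k)` with `k < i` and `w k < j`. -/
def label {n : ℕ} (w : Equiv.Perm (Fin n)) (p : ℕ × ℕ) : ℕ :=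
  (Finset.univ.filter fun k : Fin n => (k : ℕ) < p.1 ∧ (w k : ℕ) < p.2).card

/-! ### The filled Young diagram -/

/-- The index of the (northwest to southeast) diagonal on which a square lies. -/
def diag (p : ℕ × ℕ) : ℤ := (p.2 : ℤ) - (p.1 : ℤ)

/-- `lam` has as many tiles in each diagonal as `D(P_R(w))` has in the corresponding diagonal. -/
def IsShape {n : ℕ} (w : Equiv.Perm (Fin n)) (lam : YoungDiagram) : Prop :=
  ∀ d : ℤ, (lam.cells.filter fun p => diag p = d).card =
    ((blankTiles w).filter fun p => diag p = d).card

/-- The number of squares of `S` strictly before `p` (to the northwest) on the diagonal of `p`. -/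
def diagPos (S : Finset (ℕ × ℕ)) (p : ℕ × ℕ) : ℕ :=
  (S.filter fun q => diag q = diag p ∧ q.1 < p.1).card

/-- The tile `p` of `lam` corresponds to the blank tile `q` of `P_R(w)`: for some `m` and some
diagonal, both are the `m`-th tile on that diagonal, counted from the northwest. -/
def Corresponds {n : ℕ} (w : Equiv.Perm (Fin n)) (lam : YoungDiagram) (p q : ℕ × ℕ) : Prop :=
  diag p = diag q ∧ diagPos lam.cells p = diagPos (blankTiles w) q

open Classical in
/-- `τ_k(w)`: each tile of `lam` is filled with the label of the corresponding blank tile of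
`P_R(w)`; keep the tiles filled with a value at least `k`. -/
noncomputable def tau {n : ℕ} (w : Equiv.Perm (Fin n)) (lam : YoungDiagram) (k : ℕ) :
    Finset (ℕ × ℕ) :=
  lam.cells.filter fun p => ∃ q ∈ blankTiles w, Corresponds w lam p q ∧ k ≤ label w q

/-- An antidiagonal path: a set of squares that can be listed with strictly decreasing rows and
strictly increasing columns. -/
def IsAntidiagonalPath (T : Finset (ℕ × ℕ)) : Prop :=
  ∀ p ∈ T, ∀ q ∈ T, p ≠ q → (q.1 < p.1 ∧ p.2 < q.2) ∨ (p.1 < q.1 ∧ q.2 < p.2)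

open Classical in
/-- `ρ_a(S)`: the number of squares of a longest antidiagonal path contained in `S`. -/
noncomputable def rhoA (S : Finset (ℕ × ℕ)) : ℕ :=
  (S.powerset.filter IsAntidiagonalPath).sup Finset.card

/-! ### Codes and rank -/

/-- The entry `r_i` of the Rajchgot code: the minimum number of entries that must be removed from
`w i, w (i + 1), …` to leave an increasing sequence beginning with `w i`. -/
noncomputable def rajchgot {n : ℕ} (w : Equiv.Perm (Fin n)) (i : Fin n) : ℕ :=
  sInf {m : ℕ | ∃ R : Finset (Fin n), R ⊆ Finset.Ioi i ∧ R.card = m ∧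
    StrictMonoOn w (↑(Finset.Ici i \ R) : Set (Fin n))}

/-- The entry `c_i` of the Lehmer code. -/
def lehmer {n : ℕ} (w : Equiv.Perm (Fin n)) (i : Fin n) : ℕ :=
  (Finset.univ.filter fun j : Fin n => i < j ∧ w j < w i).card

open Classical in
/-- The rank of pipe `i`, i.e. of the value `i` in position `w⁻¹ i`: the length of a longest
increasing subsequence of `w` whose positions `j` satisfy `j ≤ w⁻¹ i` and `w j ≤ i`. -/
noncomputable def pipeRank {n : ℕ} (w : Equiv.Perm (Fin n)) (i : Fin n) : ℕ :=
  ((Finset.univ.filter fun j : Fin n => j ≤ w.symm i ∧ w j ≤ i).powerset.filter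
    fun T : Finset (Fin n) => StrictMonoOn w (T : Set (Fin n))).sup Finset.card

end Vexillary

/-!
Avoiding 2143 means that at every vertex `(a, c)` of the grid the dots `(k, w k)` northwest of
`(a + 1, c + 1)` or those southeast of `(a, c)` form an increasing sequence; at a blank tile it is
the first, as an inversion makes the tile blank. Where the northwest dots increase, each step down a
diagonal over a tile that is not blank raises the label by one. Hence the blank tile `(a, c)` slides
to the cell of `λ(w)` whose coordinates count the dots northeast and southwest of `(a, c)`.

Let `x` be a dot and `λ_x` the image of the blank tiles southeast of it. An increasing sequence `C`
and an antidiagonal path in `λ_x` have together at most as many elements as there are dots southeast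
of `x`: `C` misses the dots northeast or those southwest of each tile of the path, and the missed
dots are at least as many as the tiles. Equality holds: going southeast from `x` along a diagonal
until the dots northwest and those southeast of a vertex both increase, one meets enough tiles to
fill an antidiagonal of `λ_x`. So the Rajchgot code exceeds the Lehmer code at `x` by `ρ_a(λ_x)`.

Finally `τ_k(w)` is the union of the `λ_x` over the dots `x` of rank `k`, and for different dots of
the same rank these sets lie strictly northeast and southwest of each other, so that `ρ_a` is
additive.
-/

namespace Vexillary

open Finset hiding Iio Ici Ioi Iic Ioo
open Set (Iio Ici Ioi Iic Ioo)

/-! ### Largest subsets with a property -/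

section MaxCard

variable {α : Type*} {P : Finset α → Prop} {S T : Finset α}

open Classical in
/-- The largest cardinality of a subset of `S` with the property `P`. Both `rhoA` and `pipeRank` are
of this form. -/
noncomputable def maxCard (P : Finset α → Prop) (S : Finset α) : ℕ :=
  (S.powerset.filter P).sup card

theorem card_le_maxCard (hTS : T ⊆ S) (hT : P T) : #T ≤ maxCard P S := by
  classical
  exact le_sup (f := card) (mem_filter.2 ⟨mem_powerset.2 hTS, hT⟩)

theorem exists_card_eq_maxCard (hP : P ∅) (S : Finset α) : ∃ T ⊆ S, P T ∧ #T = maxCard P S := by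
  classical
  obtain ⟨T, hT, hcard⟩ := exists_mem_eq_sup (S.powerset.filter P)
    ⟨∅, mem_filter.2 ⟨empty_mem_powerset S, hP⟩⟩ card
  obtain ⟨hTS, hPT⟩ := mem_filter.1 hT
  exact ⟨T, mem_powerset.1 hTS, hPT, hcard.symm⟩

theorem maxCard_eq_card (hS : P S) : maxCard P S = #S := by
  classical
  refine le_antisymm (Finset.sup_le fun T hT => ?_) (card_le_maxCard subset_rfl hS)
  exact card_le_card (mem_powerset.1 (mem_filter.1 hT).1)

end MaxCard

theorem exists_inversion_of_not_strictMonoOn {α β : Type*} [Preorder α] [LinearOrder β]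
    {f : α → β} (hf : Function.Injective f) {s : Set α} (h : ¬ StrictMonoOn f s) :
    ∃ k ∈ s, ∃ l ∈ s, k < l ∧ f l < f k := by
  simp only [StrictMonoOn, not_forall] at h
  obtain ⟨k, hk, l, hl, hkl, hnot⟩ := h
  exact ⟨k, hk, l, hl, hkl, (not_lt.1 hnot).lt_of_ne fun e => hkl.ne' (hf e)⟩

theorem exists_card_filter_lt_eq {α β : Type*} [LinearOrder β] (s : Finset α) {f : α → β}
    (hf : Set.InjOn f s) {m : ℕ} (hm : m < #s) : ∃ x ∈ s, #{y ∈ s | f y < f x} = m := by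
  classical
  induction s using Finset.induction_on_max_value f with
  | empty => simp at hm
  | insert a s ha hmax ih =>
    have hlt : ∀ y ∈ s, f y < f a := fun y hy => (hmax y hy).lt_of_ne fun e =>
      ha (hf (mem_insert_of_mem hy) (mem_insert_self a s) e ▸ hy)
    rw [card_insert_of_notMem ha] at hm
    obtain hm | rfl := Nat.lt_succ_iff_lt_or_eq.1 hm
    · obtain ⟨x, hx, hcard⟩ := ih (hf.mono (coe_subset.2 (subset_insert a s))) hm
      refine ⟨x, mem_insert_of_mem hx, ?_⟩
      rw [filter_insert, if_neg (hlt x hx).not_gt, hcard]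
    · refine ⟨a, mem_insert_self a s, ?_⟩
      rw [filter_insert, if_neg (lt_irrefl _), filter_true_of_mem hlt]

/-! ### Antidiagonal paths -/

/-- The square `p` lies strictly northeast of the square `q`. -/
abbrev StrictlyNE (p q : ℕ × ℕ) : Prop := p.1 < q.1 ∧ q.2 < p.2

section AntidiagonalPath

variable {S T : Finset (ℕ × ℕ)}

theorem isAntidiagonalPath_empty : IsAntidiagonalPath ∅ := by simp [IsAntidiagonalPath]

theorem IsAntidiagonalPath.mono (hT : IsAntidiagonalPath T) (h : S ⊆ T) : IsAntidiagonalPath S :=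
  fun p hp q hq => hT p (h hp) q (h hq)

theorem IsAntidiagonalPath.injOn_fst (hT : IsAntidiagonalPath T) :
    Set.InjOn Prod.fst (T : Set (ℕ × ℕ)) := by
  intro p hp q hq he
  by_contra hne
  have := hT p hp q hq hne
  omega

theorem IsAntidiagonalPath.injOn_snd (hT : IsAntidiagonalPath T) :
    Set.InjOn Prod.snd (T : Set (ℕ × ℕ)) := by
  intro p hp q hq he
  by_contra hne
  have := hT p hp q hq hne
  omega

theorem rhoA_eq_maxCard (S : Finset (ℕ × ℕ)) : rhoA S = maxCard IsAntidiagonalPath S := rfl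

theorem le_rhoA_of_forall_mem {o : ℕ × ℕ} {m : ℕ}
    (h : ∀ s t, s + t + 1 = m → (o.1 + s, o.2 + t) ∈ S) : m ≤ rhoA S := by
  classical
  let cell : ℕ → ℕ × ℕ := fun s => (o.1 + s, o.2 + (m - 1 - s))
  have hcell : Function.Injective cell := fun s t e => by
    simpa [cell] using congrArg Prod.fst e
  rw [← card_range m, ← card_image_of_injective _ hcell]
  refine card_le_maxCard (fun p hp => ?_) fun p hp q hq hpq => ?_
  · obtain ⟨s, hs, rfl⟩ := mem_image.1 hp
    rw [mem_range] at hs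
    exact h s _ (by omega)
  · obtain ⟨s, hs, rfl⟩ := mem_image.1 hp
    obtain ⟨t, ht, rfl⟩ := mem_image.1 hq
    rw [mem_range] at hs ht
    have hst : s ≠ t := fun e => hpq (congrArg cell e)
    simp only [cell]
    omega

theorem rhoA_biUnion {ι : Type*} (I : Finset ι) (S : ι → Finset (ℕ × ℕ))
    (h : (I : Set ι).Pairwise fun i j =>
      ∀ p ∈ S i, ∀ q ∈ S j, StrictlyNE q p ∨ StrictlyNE p q) :
    rhoA (I.biUnion S) = ∑ i ∈ I, rhoA (S i) := by
  classical
  simp only [rhoA_eq_maxCard]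
  apply le_antisymm
  · obtain ⟨T, hTS, hT, hcard⟩ := exists_card_eq_maxCard isAntidiagonalPath_empty (I.biUnion S)
    calc maxCard IsAntidiagonalPath (I.biUnion S) = #(I.biUnion fun i => T ∩ S i) := by
          rw [← inter_biUnion, inter_eq_left.2 hTS, hcard]
      _ ≤ ∑ i ∈ I, #(T ∩ S i) := card_biUnion_le
      _ ≤ ∑ i ∈ I, maxCard IsAntidiagonalPath (S i) := sum_le_sum fun i _ =>
          card_le_maxCard inter_subset_right (hT.mono inter_subset_left)
  · choose T hTS hT hcard using fun i => exists_card_eq_maxCard isAntidiagonalPath_empty (S i)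
    have hdisj : ∀ i ∈ I, ∀ j ∈ I, i ≠ j → Disjoint (T i) (T j) := fun i hi j hj hij =>
      disjoint_left.2 fun p hp hq => by
        have := h hi hj hij p (hTS i hp) p (hTS j hq)
        omega
    have hpath : IsAntidiagonalPath (I.biUnion T) := by
      intro p hp q hq hpq
      obtain ⟨i, hi, hp⟩ := mem_biUnion.1 hp
      obtain ⟨j, hj, hq⟩ := mem_biUnion.1 hq
      obtain rfl | hij := eq_or_ne i j
      · exact hT i p hp q hq hpq
      · exact h hi hj hij p (hTS i hp) q (hTS j hq)
    calc ∑ i ∈ I, maxCard IsAntidiagonalPath (S i) = #(I.biUnion T) := by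
          rw [card_biUnion hdisj]
          exact sum_congr rfl fun i _ => (hcard i).symm
      _ ≤ maxCard IsAntidiagonalPath (I.biUnion S) :=
          card_le_maxCard (biUnion_mono fun i _ => hTS i) hpath

end AntidiagonalPath

/-! ### Sliding the squares of a set to the northwest -/

section Slide

variable {S : Finset (ℕ × ℕ)} {p q : ℕ × ℕ}

/-- The square on the diagonal of `p` to which `p` moves when the squares of `S` slide northwest
along their diagonals as far as they can. The truncated differences vanish for the smaller
coordinate, so that `diagPos S p` becomes the smaller coordinate of the new square. -/
def slide (S : Finset (ℕ × ℕ)) (p : ℕ × ℕ) : ℕ × ℕ :=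
  (p.1 - p.2 + diagPos S p, p.2 - p.1 + diagPos S p)

theorem slide_eq_iff : slide S p = q ↔ diag q = diag p ∧ min q.1 q.2 = diagPos S p := by
  rw [Prod.ext_iff]
  simp only [slide, diag]
  omega

theorem diag_slide (S : Finset (ℕ × ℕ)) (p : ℕ × ℕ) : diag (slide S p) = diag p :=
  (slide_eq_iff.1 rfl).1

theorem min_slide (S : Finset (ℕ × ℕ)) (p : ℕ × ℕ) :
    min (slide S p).1 (slide S p).2 = diagPos S p :=
  (slide_eq_iff.1 rfl).2

theorem diagPos_succ (S : Finset (ℕ × ℕ)) (a c : ℕ) :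
    diagPos S (a + 1, c + 1) = diagPos S (a, c) + if (a, c) ∈ S then 1 else 0 := by
  have hsplit : ∀ q : ℕ × ℕ, diag q = diag (a + 1, c + 1) ∧ q.1 < a + 1 ↔
      (diag q = diag (a, c) ∧ q.1 < a) ∨ q = (a, c) := fun q => by
    rw [Prod.ext_iff]
    simp only [diag]
    omega
  have hdisj : Disjoint {q ∈ S | diag q = diag (a, c) ∧ q.1 < a} {q ∈ S | q = (a, c)} :=
    disjoint_filter.2 fun q _ h e => by simp [e] at h
  simp only [diagPos, hsplit]
  rw [filter_or, card_union_of_disjoint hdisj, filter_eq']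
  split_ifs <;> simp

theorem diagPos_le_card (S : Finset (ℕ × ℕ)) (p : ℕ × ℕ) :
    diagPos S p ≤ #{q ∈ S | diag q = diag p} :=
  card_le_card fun q => by simp +contextual

theorem diagPos_lt_card (hp : p ∈ S) : diagPos S p < #{q ∈ S | diag q = diag p} :=
  card_lt_card <| (ssubset_iff_of_subset fun q => by simp +contextual).2 ⟨p, by simp [hp]⟩

theorem diagPos_lt_diagPos (hp : p ∈ S) (hd : diag p = diag q) (h : p.1 < q.1) :
    diagPos S p < diagPos S q := by
  refine card_lt_card <| (ssubset_iff_of_subset fun r => ?_).2 ⟨p, by simp [hp, hd, h]⟩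
  simp only [mem_filter, hd]
  exact fun hr => ⟨hr.1, hr.2.1, hr.2.2.trans h⟩

theorem slide_fst_lt_slide_fst (hp : p ∈ S) (hd : diag p = diag q) (h : p.1 < q.1) :
    (slide S p).1 < (slide S q).1 := by
  have := diagPos_lt_diagPos hp hd h
  simp only [slide, diag] at hd ⊢
  omega

theorem injOn_fst_filter_diag (S : Finset (ℕ × ℕ)) (d : ℤ) :
    Set.InjOn Prod.fst ({q ∈ S | diag q = d} : Set (ℕ × ℕ)) := by
  rintro p ⟨-, hp⟩ q ⟨-, hq⟩ h
  simp only [diag] at hp hq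
  exact Prod.ext h (by omega)

theorem slide_injOn (S : Finset (ℕ × ℕ)) : Set.InjOn (slide S) (S : Set (ℕ × ℕ)) := by
  intro p hp q hq he
  obtain ⟨hd, hpos⟩ := slide_eq_iff.1 he
  rw [diag_slide] at hd
  rw [min_slide] at hpos
  obtain h | h | h := lt_trichotomy p.1 q.1
  · exact absurd (diagPos_lt_diagPos hp hd.symm h) hpos.not_gt
  · exact injOn_fst_filter_diag S (diag p) ⟨hp, rfl⟩ ⟨hq, hd⟩ h
  · exact absurd (diagPos_lt_diagPos hq hd h) hpos.not_lt

theorem mem_image_slide : p ∈ S.image (slide S) ↔ min p.1 p.2 < #{q ∈ S | diag q = diag p} := by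
  rw [mem_image]
  constructor
  · rintro ⟨b, hb, hbp⟩
    obtain ⟨hd, hmin⟩ := slide_eq_iff.1 hbp
    rw [hd, hmin]
    exact diagPos_lt_card hb
  · intro h
    obtain ⟨b, hb, hcard⟩ := exists_card_filter_lt_eq _ (by simpa using injOn_fst_filter_diag S _) h
    obtain ⟨hbS, hd⟩ := mem_filter.1 hb
    rw [filter_filter, ← hd] at hcard
    exact ⟨b, hbS, slide_eq_iff.2 ⟨hd.symm, hcard.symm⟩⟩

theorem card_filter_diag_image_slide (S : Finset (ℕ × ℕ)) (d : ℤ) :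
    #{p ∈ S.image (slide S) | diag p = d} = #{p ∈ S | diag p = d} := by
  rw [filter_image, card_image_of_injOn ((slide_injOn S).mono fun p hp => (mem_filter.1 hp).1)]
  simp only [diag_slide]

theorem diagPos_cells {lam : YoungDiagram} (hp : p ∈ lam.cells) :
    diagPos lam.cells p = min p.1 p.2 := by
  obtain ⟨x, y⟩ := p
  have hdiag : {q ∈ lam.cells | diag q = diag (x, y) ∧ q.1 < x} =
      (range (min x y)).image fun t => (x - min x y + t, y - min x y + t) := by
    ext ⟨a, b⟩
    rw [mem_filter, mem_image]
    simp only [mem_range, Prod.mk.injEq, diag]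
    constructor
    · rintro ⟨-, hd, ha⟩
      exact ⟨a - (x - min x y), by omega, by omega, by omega⟩
    · rintro ⟨t, ht, rfl, rfl⟩
      exact ⟨lam.up_left_mem (by omega) (by omega) hp, by omega, by omega⟩
  rw [diagPos, hdiag, card_image_of_injective, card_range]
  intro s t h
  simp only [Prod.mk.injEq] at h
  omega

theorem image_slide_cells (lam : YoungDiagram) :
    lam.cells.image (slide lam.cells) = lam.cells := by
  have hfix : ∀ p ∈ lam.cells, slide lam.cells p = p := fun p hp =>
    slide_eq_iff.2 ⟨rfl, (diagPos_cells hp).symm⟩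
  rw [image_congr hfix, image_id']

end Slide

variable {n : ℕ} {w : Equiv.Perm (Fin n)}

theorem isShape_iff {lam : YoungDiagram} :
    IsShape w lam ↔ lam.cells = (blankTiles w).image (slide (blankTiles w)) := by
  constructor
  · intro h
    rw [← image_slide_cells lam]
    ext p
    rw [mem_image_slide, mem_image_slide, h]
  · intro h d
    rw [h, card_filter_diag_image_slide]

theorem tau_eq {lam : YoungDiagram} (h : IsShape w lam) (k : ℕ) :
    tau w lam k = {b ∈ blankTiles w | k ≤ label w b}.image (slide (blankTiles w)) := by
  have hcells : ∀ q ∈ blankTiles w, slide (blankTiles w) q ∈ lam.cells := fun q hq =>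
    isShape_iff.1 h ▸ mem_image_of_mem _ hq
  ext p
  simp only [tau, mem_filter, mem_image]
  constructor
  · rintro ⟨hp, q, hq, ⟨hd, hpos⟩, hk⟩
    exact ⟨q, ⟨hq, hk⟩, slide_eq_iff.2 ⟨hd, by rw [← hpos, diagPos_cells hp]⟩⟩
  · rintro ⟨q, ⟨hq, hk⟩, rfl⟩
    refine ⟨hcells q hq, q, hq, ⟨diag_slide _ q, ?_⟩, hk⟩
    rw [diagPos_cells (hcells q hq), min_slide]

/-! ### Dots, chains and labels -/

open Classical in
/-- The dots `(k, w k)` of `w` whose row lies in `R` and whose column lies in `C`, recorded by their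
rows. -/
noncomputable def dots (w : Equiv.Perm (Fin n)) (R C : Set ℕ) : Finset (Fin n) :=
  {k | (k : ℕ) ∈ R ∧ (w k : ℕ) ∈ C}

/-- The dots of `w` northwest of the vertex `(a, c)`, the one at the top left corner of the square
`(a, c)`, form an increasing sequence. -/
def NWChain (w : Equiv.Perm (Fin n)) (a c : ℕ) : Prop :=
  StrictMonoOn w (dots w (Iio a) (Iio c) : Set (Fin n))

/-- The dots of `w` southeast of the vertex `(a, c)` form an increasing sequence. -/
def SEChain (w : Equiv.Perm (Fin n)) (a c : ℕ) : Prop :=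
  StrictMonoOn w (dots w (Ici a) (Ici c) : Set (Fin n))

/-- The number of dots of `w` northeast of the vertex `(a, c)`. -/
noncomputable def neCount (w : Equiv.Perm (Fin n)) (a c : ℕ) : ℕ := #(dots w (Iio a) (Ici c))

/-- The number of dots of `w` southwest of the vertex `(a, c)`. -/
noncomputable def swCount (w : Equiv.Perm (Fin n)) (a c : ℕ) : ℕ := #(dots w (Ici a) (Iio c))

section Dots

variable {R R' C C' : Set ℕ} {a a' c c' : ℕ}

@[simp]
theorem mem_dots {k : Fin n} : k ∈ dots w R C ↔ (k : ℕ) ∈ R ∧ (w k : ℕ) ∈ C := by simp [dots]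

theorem dots_subset_dots (hR : R ⊆ R') (hC : C ⊆ C') : dots w R C ⊆ dots w R' C' := fun _ hk =>
  mem_dots.2 ((mem_dots.1 hk).imp (@hR _) (@hC _))

theorem card_dots_symm : #(dots w.symm C R) = #(dots w R C) :=
  card_equiv w.symm fun j => by simp [and_comm]

theorem label_eq_card_dots : label w (a, c) = #(dots w (Iio a) (Iio c)) := by
  simp [label, dots]

theorem label_symm : label w.symm (c, a) = label w (a, c) := by
  simp only [label_eq_card_dots, card_dots_symm]

theorem swCount_eq_neCount_symm : swCount w a c = neCount w.symm c a :=
  card_dots_symm.symm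

theorem label_mono (ha : a ≤ a') (hc : c ≤ c') : label w (a, c) ≤ label w (a', c') := by
  simp only [label_eq_card_dots]
  exact card_le_card (dots_subset_dots (Set.Iio_subset_Iio ha) (Set.Iio_subset_Iio hc))

theorem label_succ_fst (i : Fin n) (c : ℕ) :
    label w ((i : ℕ) + 1, c) = label w ((i : ℕ), c) + if (w i : ℕ) < c then 1 else 0 := by
  have hsplit : ∀ k : Fin n, (k : ℕ) < i + 1 ∧ (w k : ℕ) < c ↔
      ((k : ℕ) < i ∧ (w k : ℕ) < c) ∨ (k = i ∧ (w i : ℕ) < c) := fun k => by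
    obtain rfl | hki := eq_or_ne k i
    · simp
    · have := Fin.val_ne_of_ne hki
      simp only [hki, false_and, or_false]
      omega
  have hdisj : Disjoint ({k | (k : ℕ) < i ∧ (w k : ℕ) < c} : Finset (Fin n))
      ({k | k = i ∧ (w i : ℕ) < c} : Finset (Fin n)) :=
    disjoint_filter.2 fun k _ h e => by simp [e.1] at h
  simp only [label, hsplit]
  rw [filter_or, card_union_of_disjoint hdisj]
  split_ifs with h <;> simp [h, filter_eq']

theorem label_succ_snd (a : ℕ) (e : Fin n) :
    label w (a, (w e : ℕ) + 1) = label w (a, (w e : ℕ)) + if (e : ℕ) < a then 1 else 0 := by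
  rw [← label_symm, label_succ_fst, label_symm, Equiv.symm_apply_apply]

theorem neCount_add_label (ha : a ≤ n) : neCount w a c + label w (a, c) = a := by
  have hsplit := card_filter_add_card_filter_not (s := {k : Fin n | (k : ℕ) < a})
    fun k => c ≤ (w k : ℕ)
  rw [Fin.card_filter_val_lt, min_eq_right ha, filter_filter, filter_filter] at hsplit
  simpa [neCount, label, dots] using hsplit

theorem swCount_add_label (hc : c ≤ n) : swCount w a c + label w (a, c) = c := by
  rw [swCount_eq_neCount_symm, ← label_symm, neCount_add_label hc]

theorem NWChain.mono (h : NWChain w a c) (ha : a' ≤ a) (hc : c' ≤ c) : NWChain w a' c' :=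
  StrictMonoOn.mono h <|
    coe_subset.2 <| dots_subset_dots (Set.Iio_subset_Iio ha) (Set.Iio_subset_Iio hc)

theorem seChain_of_le (h : n ≤ a ∨ n ≤ c) : SEChain w a c := by
  intro k hk
  simp only [mem_coe, mem_dots, Set.mem_Ici] at hk
  omega

theorem IsVexillary.nwChain_succ_or_seChain (hw : IsVexillary w) (a c : ℕ) :
    NWChain w (a + 1) (c + 1) ∨ SEChain w a c := by
  by_contra! h
  obtain ⟨k, hk, l, hl, hkl, hwlk⟩ := exists_inversion_of_not_strictMonoOn w.injective h.1
  obtain ⟨p, hp, q, hq, hpq, hwqp⟩ := exists_inversion_of_not_strictMonoOn w.injective h.2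
  simp only [mem_coe, mem_dots, Set.mem_Iio, Set.mem_Ici] at hk hl hp hq
  have hlp : l ≠ p := by rintro rfl; omega
  have hwkq : w k ≠ w q := w.injective.ne (by omega)
  exact hw ⟨k, l, p, q, hkl, by omega, hpq, hwlk, by omega, hwqp⟩

theorem mem_blankTiles {p : ℕ × ℕ} :
    p ∈ blankTiles w ↔ ∃ i e : Fin n, i < e ∧ w e < w i ∧ p = ((i : ℕ), (w e : ℕ)) := by
  have hblank : ∀ i j, rotheBPD w i j = Tile.blank ↔ i < w.symm j ∧ j < w i := by
    intro i j
    obtain ⟨e, rfl⟩ := w.surjective j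
    have := w.injective.eq_iff (a := i) (b := e)
    unfold rotheBPD
    split_ifs <;> simp only [Equiv.symm_apply_apply, true_iff, false_iff] at * <;> omega
  simp only [blankTiles, mem_image, mem_filter_univ, hblank, Prod.exists]
  constructor
  · rintro ⟨i, j, ⟨hie, hj⟩, rfl⟩
    exact ⟨i, w.symm j, hie, by simpa using hj, by simp⟩
  · rintro ⟨i, e, hie, hj, rfl⟩
    exact ⟨i, w e, ⟨by simpa using hie, hj⟩, rfl⟩

theorem not_seChain_of_mem_blankTiles (h : (a, c) ∈ blankTiles w) : ¬ SEChain w a c := by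
  obtain ⟨i, e, hie, hwei, hac⟩ := mem_blankTiles.1 h
  obtain ⟨rfl, rfl⟩ := Prod.mk.inj hac
  intro hSE
  exact (hSE (by simpa using hwei.le) (by simpa using hie.le) hie).not_gt hwei

theorem IsVexillary.nwChain_of_mem_blankTiles (hw : IsVexillary w) (h : (a, c) ∈ blankTiles w) :
    NWChain w (a + 1) (c + 1) :=
  (hw.nwChain_succ_or_seChain a c).resolve_right (not_seChain_of_mem_blankTiles h)

theorem label_succ_of_mem_blankTiles (h : (a, c) ∈ blankTiles w) :
    label w (a + 1, c + 1) = label w (a, c) := by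
  obtain ⟨i, e, hie, hwei, hac⟩ := mem_blankTiles.1 h
  obtain ⟨rfl, rfl⟩ := Prod.mk.inj hac
  rw [label_succ_fst, label_succ_snd, if_neg (by omega), if_neg (by omega), add_zero, add_zero]

theorem NWChain.label_succ_of_notMem (h : NWChain w (a + 1) (c + 1)) (ha : a < n) (hc : c < n)
    (hblank : (a, c) ∉ blankTiles w) : label w (a + 1, c + 1) = label w (a, c) + 1 := by
  obtain ⟨i, rfl⟩ : ∃ i : Fin n, (i : ℕ) = a := ⟨⟨a, ha⟩, rfl⟩
  obtain ⟨e, rfl⟩ : ∃ e : Fin n, (w e : ℕ) = c := ⟨w.symm ⟨c, hc⟩, by simp⟩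
  have hinv : ¬ (i < e ∧ w e < w i) := fun hie =>
    hblank (mem_blankTiles.2 ⟨i, e, hie.1, hie.2, rfl⟩)
  have hchain : e < i → ¬ w i < w e := fun hei hlt =>
    (h (by simp; omega) (by simp; omega) hei).not_gt hlt
  have := w.injective.eq_iff (a := i) (b := e)
  rw [label_succ_fst, label_succ_snd]
  split_ifs <;> omega

theorem lt_of_mem_blankTiles {p : ℕ × ℕ} (h : p ∈ blankTiles w) : p.1 < n ∧ p.2 < n := by
  obtain ⟨i, e, -, -, rfl⟩ := mem_blankTiles.1 h
  exact ⟨i.2, (w e).2⟩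

theorem NWChain.diagPos_add_label (h : NWChain w a c) (ha : a ≤ n) (hc : c ≤ n) :
    diagPos (blankTiles w) (a, c) + label w (a, c) = min a c := by
  induction a generalizing c with
  | zero => simp [diagPos, label]
  | succ a ih =>
    cases c with
    | zero =>
      have hpos : diagPos (blankTiles w) (a + 1, 0) = 0 :=
        card_eq_zero.2 <| filter_eq_empty_iff.2 fun q _ => by simp only [diag]; omega
      simp [hpos, label]
    | succ c =>
      have := ih (h.mono a.le_succ c.le_succ) (by omega) (by omega)
      rw [diagPos_succ]
      split_ifs with hblank
      · rw [label_succ_of_mem_blankTiles hblank]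
        omega
      · rw [h.label_succ_of_notMem (by omega) (by omega) hblank]
        omega

theorem NWChain.slide_blankTiles (h : NWChain w a c) (ha : a ≤ n) (hc : c ≤ n) :
    slide (blankTiles w) (a, c) = (neCount w a c, swCount w a c) := by
  have hne := neCount_add_label (w := w) (c := c) ha
  have hsw := swCount_add_label (w := w) (a := a) hc
  have := h.diagPos_add_label ha hc
  rw [slide_eq_iff]
  simp only [diag]
  omega

theorem IsVexillary.slide_of_mem_blankTiles (hw : IsVexillary w) {b : ℕ × ℕ}
    (hb : b ∈ blankTiles w) :
    slide (blankTiles w) b = (neCount w b.1 b.2, swCount w b.1 b.2) :=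
  ((hw.nwChain_of_mem_blankTiles hb).mono b.1.le_succ b.2.le_succ).slide_blankTiles
    (lt_of_mem_blankTiles hb).1.le (lt_of_mem_blankTiles hb).2.le

theorem NWChain.mem_image_slide {q : ℕ × ℕ} (h : NWChain w a c) (ha : a ≤ n) (hc : c ≤ n)
    (hd : diag q = diag (a, c)) (hq : q.1 < neCount w a c) :
    q ∈ (blankTiles w).image (slide (blankTiles w)) := by
  have hne := neCount_add_label (w := w) (c := c) ha
  have hpos := h.diagPos_add_label ha hc
  have hle := diagPos_le_card (blankTiles w) (a, c)
  rw [Vexillary.mem_image_slide, hd]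
  simp only [diag] at hd
  omega

theorem IsVexillary.isLowerSet_image_slide (hw : IsVexillary w) :
    IsLowerSet ((blankTiles w).image (slide (blankTiles w)) : Set (ℕ × ℕ)) := by
  rintro p ⟨x', y'⟩ hle hp
  obtain ⟨⟨i, j⟩, hb, rfl⟩ := mem_image.1 hp
  obtain ⟨hi, hj⟩ : i < n ∧ j < n := lt_of_mem_blankTiles hb
  have hchain := hw.nwChain_of_mem_blankTiles hb
  rw [hw.slide_of_mem_blankTiles hb] at hle
  obtain ⟨hx, hy⟩ : x' ≤ neCount w i j ∧ y' ≤ swCount w i j := hle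
  have hne := neCount_add_label (w := w) (c := j) hi.le
  have hsw := swCount_add_label (w := w) (a := i) hj.le
  let a := i + 1 - (neCount w i j - x')
  let c := j + 1 - (swCount w i j - y')
  have ha : a ≤ i + 1 := Nat.sub_le _ _
  have hc : c ≤ j + 1 := Nat.sub_le _ _
  have hlabel : label w (a, c) ≤ label w (i, j) :=
    label_succ_of_mem_blankTiles hb ▸ label_mono ha hc
  have hne' := neCount_add_label (w := w) (c := c) (ha.trans hi)
  refine (hchain.mono ha hc).mem_image_slide (ha.trans hi) (hc.trans hj) ?_ ?_
  · simp only [diag, a, c]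
    omega
  · simp only [a] at hlabel hne' ⊢
    omega

theorem IsVexillary.existsUnique_isShape (hw : IsVexillary w) :
    ∃! lam : YoungDiagram, IsShape w lam :=
  ⟨⟨_, hw.isLowerSet_image_slide⟩, isShape_iff.2 rfl,
    fun _ h => YoungDiagram.ext (isShape_iff.1 h)⟩

end Dots

/-! ### Increasing sequences and antidiagonal paths southeast of a dot -/

/-- The dots of `w` southeast of the dot in row `x`. -/
noncomputable def seDots (w : Equiv.Perm (Fin n)) (x : Fin n) : Finset (Fin n) :=
  dots w (Ioi x) (Ioi (w x))

/-- The dots of `w` northeast of the vertex `(a, c)` and below row `x`. -/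
noncomputable def neDots (w : Equiv.Perm (Fin n)) (x : Fin n) (a c : ℕ) : Finset (Fin n) :=
  dots w (Ioo x a) (Ici c)

/-- The dots of `w` southwest of the vertex `(a, c)` and to the right of column `w x`. -/
noncomputable def swDots (w : Equiv.Perm (Fin n)) (x : Fin n) (a c : ℕ) : Finset (Fin n) :=
  dots w (Ici a) (Ioo (w x) c)

/-- The blank tiles southeast of the dot in row `x`. -/
def blankTilesSE (w : Equiv.Perm (Fin n)) (x : Fin n) : Finset (ℕ × ℕ) :=
  {b ∈ blankTiles w | (x : ℕ) < b.1 ∧ (w x : ℕ) < b.2}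

/-- The part of the Young diagram of `w` that comes from the blank tiles southeast of the dot in row
`x`. -/
def shapeSE (w : Equiv.Perm (Fin n)) (x : Fin n) : Finset (ℕ × ℕ) :=
  (blankTilesSE w x).image (slide (blankTiles w))

/-- A square weakly northwest of all squares of `shapeSE w x`. It is where `(x + 1, w x + 1)` slides
to if the dots northwest of that vertex form an increasing sequence. -/
noncomputable def corner (w : Equiv.Perm (Fin n)) (x : Fin n) : ℕ × ℕ :=
  (neCount w (x + 1) (w x + 1), swCount w (x + 1) (w x + 1))

section AtDot

variable {x : Fin n} {a c : ℕ} {b : ℕ × ℕ}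

theorem NWChain.symm (h : NWChain w a c) : NWChain w.symm c a := by
  intro k hk l hl hkl
  simp only [mem_coe, mem_dots, Set.mem_Iio] at hk hl
  refine lt_of_not_ge fun hle => ?_
  have hlt : w.symm l < w.symm k := hle.lt_of_ne (w.symm.injective.ne hkl.ne')
  have := h (by simpa using hl.symm) (by simpa using hk.symm) hlt
  simp only [Equiv.apply_symm_apply] at this
  exact this.not_gt hkl

theorem NWChain.card_neDots (h : NWChain w a c) (hxa : (x : ℕ) < a) (hxc : (w x : ℕ) < c) :
    #(neDots w x a c) + (corner w x).1 = neCount w a c := by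
  have hsplit : dots w (Iio a) (Ici c) =
      neDots w x a c ∪ dots w (Iio (x + 1)) (Ici (w x + 1)) := by
    ext k
    have hk : (k : ℕ) < x → (w k : ℕ) < c → w k < w x := fun hkx hkc =>
      h (by simp; omega) (by simp; omega) hkx
    have : k = x ↔ w k = w x := w.injective.eq_iff.symm
    simp only [neDots, mem_union, mem_dots, Set.mem_Iio, Set.mem_Ici, Set.mem_Ioo]
    omega
  have hdisj : Disjoint (neDots w x a c) (dots w (Iio (x + 1)) (Ici (w x + 1))) :=
    disjoint_left.2 fun k => by
      simp only [neDots, mem_dots, Set.mem_Iio, Set.mem_Ioo]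
      omega
  rw [neCount, hsplit, card_union_of_disjoint hdisj]
  rfl

theorem NWChain.card_swDots (h : NWChain w a c) (hxa : (x : ℕ) < a) (hxc : (w x : ℕ) < c) :
    #(swDots w x a c) + (corner w x).2 = swCount w a c := by
  have := h.symm.card_neDots (x := w x) hxc (by simpa using hxa)
  simpa only [swDots, neDots, corner, swCount, neCount, Equiv.symm_apply_apply, card_dots_symm]
    using this

theorem corner_fst_add_label (w : Equiv.Perm (Fin n)) (x : Fin n) :
    (corner w x).1 + label w ((x : ℕ) + 1, (w x : ℕ) + 1) = x + 1 :=
  neCount_add_label x.2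

theorem corner_snd_add_label (w : Equiv.Perm (Fin n)) (x : Fin n) :
    (corner w x).2 + label w ((x : ℕ) + 1, (w x : ℕ) + 1) = w x + 1 :=
  swCount_add_label (w x).2

theorem IsVexillary.slide_fst_add_label (hw : IsVexillary w) (hb : b ∈ blankTiles w) :
    (slide (blankTiles w) b).1 + label w b = b.1 := by
  rw [hw.slide_of_mem_blankTiles hb, neCount_add_label (lt_of_mem_blankTiles hb).1.le]

theorem IsVexillary.slide_snd_add_label (hw : IsVexillary w) (hb : b ∈ blankTiles w) :
    (slide (blankTiles w) b).2 + label w b = b.2 := by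
  rw [hw.slide_of_mem_blankTiles hb, swCount_add_label (lt_of_mem_blankTiles hb).2.le]

theorem neCount_succ_of_mem_blankTiles (h : (a, c) ∈ blankTiles w) :
    neCount w (a + 1) (c + 1) = neCount w a c + 1 := by
  have ha : a < n := (lt_of_mem_blankTiles h).1
  have hne := neCount_add_label (w := w) (c := c) ha.le
  have hne' := neCount_add_label (w := w) (a := a + 1) (c := c + 1) ha
  rw [label_succ_of_mem_blankTiles h] at hne'
  omega

theorem swCount_succ_of_mem_blankTiles (h : (a, c) ∈ blankTiles w) :
    swCount w (a + 1) (c + 1) = swCount w a c + 1 := by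
  have hc : c < n := (lt_of_mem_blankTiles h).2
  have hsw := swCount_add_label (w := w) (a := a) hc.le
  have hsw' := swCount_add_label (w := w) (a := a + 1) (c := c + 1) hc
  rw [label_succ_of_mem_blankTiles h] at hsw'
  omega

theorem mem_blankTilesSE :
    b ∈ blankTilesSE w x ↔ b ∈ blankTiles w ∧ (x : ℕ) < b.1 ∧ (w x : ℕ) < b.2 := mem_filter

theorem blankTilesSE_subset : blankTilesSE w x ⊆ blankTiles w := filter_subset _ _

theorem IsVexillary.card_neDots (hw : IsVexillary w) (hb : b ∈ blankTilesSE w x) :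
    #(neDots w x (b.1 + 1) (b.2 + 1)) + (corner w x).1 = (slide (blankTiles w) b).1 + 1 := by
  obtain ⟨hb, hxa, hxc⟩ := mem_blankTilesSE.1 hb
  rw [(hw.nwChain_of_mem_blankTiles hb).card_neDots (hxa.trans b.1.lt_succ_self)
    (hxc.trans b.2.lt_succ_self), neCount_succ_of_mem_blankTiles hb, hw.slide_of_mem_blankTiles hb]

theorem IsVexillary.card_swDots (hw : IsVexillary w) (hb : b ∈ blankTilesSE w x) :
    #(swDots w x (b.1 + 1) (b.2 + 1)) + (corner w x).2 = (slide (blankTiles w) b).2 + 1 := by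
  obtain ⟨hb, hxa, hxc⟩ := mem_blankTilesSE.1 hb
  rw [(hw.nwChain_of_mem_blankTiles hb).card_swDots (hxa.trans b.1.lt_succ_self)
    (hxc.trans b.2.lt_succ_self), swCount_succ_of_mem_blankTiles hb, hw.slide_of_mem_blankTiles hb]

theorem IsVexillary.corner_le_slide (hw : IsVexillary w) (hb : b ∈ blankTilesSE w x) :
    corner w x ≤ slide (blankTiles w) b := by
  obtain ⟨hb, hxa, hxc⟩ := mem_blankTilesSE.1 hb
  have h := (hw.nwChain_of_mem_blankTiles hb).mono b.1.le_succ b.2.le_succ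
  rw [hw.slide_of_mem_blankTiles hb, ← h.card_neDots hxa hxc, ← h.card_swDots hxa hxc]
  exact ⟨Nat.le_add_left _ _, Nat.le_add_left _ _⟩

end AtDot

theorem card_le_card_biUnion_of_injOn {α β : Type*} [DecidableEq α] {B : Finset β}
    {N : β → Finset α} {f : β → ℕ} {m : ℕ} (hf : Set.InjOn f B)
    (h : ∀ b ∈ B, m ≤ f b ∧ f b < #(N b) + m) : #B ≤ #(B.biUnion N) := by
  obtain rfl | hB := B.eq_empty_or_nonempty
  · simp
  obtain ⟨b, hb, hmax⟩ := exists_max_image B f hB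
  calc #B = #(B.image f) := (card_image_of_injOn hf).symm
    _ ≤ #(Finset.Icc m (f b)) := card_le_card <| image_subset_iff.2 fun b' hb' =>
        Finset.mem_Icc.2 ⟨(h b' hb').1, hmax b' hb'⟩
    _ ≤ #(N b) := by
        have := h b hb
        rw [Nat.card_Icc]
        omega
    _ ≤ #(B.biUnion N) := card_le_card (subset_biUnion_of_mem N hb)

section UpperBound

variable {x : Fin n} {C : Finset (Fin n)} {B : Finset (ℕ × ℕ)}

theorem disjoint_swDots_of_not_disjoint_neDots {a c : ℕ} (hC : StrictMonoOn w (C : Set (Fin n)))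
    (h : ¬ Disjoint C (neDots w x a c)) : Disjoint C (swDots w x a c) := by
  obtain ⟨j, hjC, hj⟩ := not_disjoint_iff.1 h
  refine disjoint_left.2 fun l hlC hl => ?_
  simp only [neDots, swDots, mem_dots, Set.mem_Ioo, Set.mem_Ici] at hj hl
  have := hC hjC hlC (by omega)
  omega

theorem disjoint_neDots_swDots {a c a' c' : ℕ} (hmissed : Disjoint C (neDots w x a c))
    (hmet : ¬ Disjoint C (neDots w x a' c')) : Disjoint (neDots w x a c) (swDots w x a' c') := by
  obtain ⟨k, hkC, hk'⟩ := not_disjoint_iff.1 hmet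
  have hk := disjoint_left.1 hmissed hkC
  refine disjoint_left.2 fun j hj hj' => ?_
  simp only [neDots, swDots, mem_dots, Set.mem_Ioo, Set.mem_Ici] at hk hk' hj hj'
  omega

theorem IsVexillary.card_le_card_biUnion_neDots (hw : IsVexillary w) (hB : B ⊆ blankTilesSE w x)
    (hpath : IsAntidiagonalPath (B.image (slide (blankTiles w)))) :
    #B ≤ #(B.biUnion fun b => neDots w x (b.1 + 1) (b.2 + 1)) := by
  refine card_le_card_biUnion_of_injOn (f := fun b => (slide (blankTiles w) b).1)
    (m := (corner w x).1) (fun s hs t ht hst => ?_) fun b hb =>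
      ⟨(hw.corner_le_slide (hB hb)).1, by rw [hw.card_neDots (hB hb)]; exact Nat.lt_succ_self _⟩
  exact slide_injOn _ (blankTilesSE_subset (hB hs)) (blankTilesSE_subset (hB ht))
    (hpath.injOn_fst (mem_image_of_mem _ hs) (mem_image_of_mem _ ht) hst)

theorem IsVexillary.card_le_card_biUnion_swDots (hw : IsVexillary w) (hB : B ⊆ blankTilesSE w x)
    (hpath : IsAntidiagonalPath (B.image (slide (blankTiles w)))) :
    #B ≤ #(B.biUnion fun b => swDots w x (b.1 + 1) (b.2 + 1)) := by
  refine card_le_card_biUnion_of_injOn (f := fun b => (slide (blankTiles w) b).2)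
    (m := (corner w x).2) (fun s hs t ht hst => ?_) fun b hb =>
      ⟨(hw.corner_le_slide (hB hb)).2, by rw [hw.card_swDots (hB hb)]; exact Nat.lt_succ_self _⟩
  exact slide_injOn _ (blankTilesSE_subset (hB hs)) (blankTilesSE_subset (hB ht))
    (hpath.injOn_snd (mem_image_of_mem _ hs) (mem_image_of_mem _ ht) hst)

theorem IsVexillary.card_add_card_le (hw : IsVexillary w) (hCx : C ⊆ seDots w x)
    (hC : StrictMonoOn w (C : Set (Fin n))) (hB : B ⊆ blankTilesSE w x)
    (hpath : IsAntidiagonalPath (B.image (slide (blankTiles w)))) :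
    #C + #B ≤ #(seDots w x) := by
  let N : ℕ × ℕ → Finset (Fin n) := fun b => neDots w x (b.1 + 1) (b.2 + 1)
  let S : ℕ × ℕ → Finset (Fin n) := fun b => swDots w x (b.1 + 1) (b.2 + 1)
  let missed := {b ∈ B | Disjoint C (N b)}
  let met := {b ∈ B | ¬ Disjoint C (N b)}
  have hmissed : missed ⊆ B := filter_subset _ _
  have hmet : met ⊆ B := filter_subset _ _
  have hCN : Disjoint C (missed.biUnion N) :=
    disjoint_biUnion_right _ _ _ |>.2 fun b hb => (mem_filter.1 hb).2
  have hCS : Disjoint C (met.biUnion S) := disjoint_biUnion_right _ _ _ |>.2 fun b hb =>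
    disjoint_swDots_of_not_disjoint_neDots hC (mem_filter.1 hb).2
  have hNS : Disjoint (missed.biUnion N) (met.biUnion S) :=
    disjoint_biUnion_left _ _ _ |>.2 fun s hs => disjoint_biUnion_right _ _ _ |>.2 fun t ht =>
      disjoint_neDots_swDots (mem_filter.1 hs).2 (mem_filter.1 ht).2
  have hsub : (C ∪ missed.biUnion N) ∪ met.biUnion S ⊆ seDots w x := by
    refine union_subset (union_subset hCx (biUnion_subset.2 fun b hb => ?_))
      (biUnion_subset.2 fun b hb => ?_)
    · obtain ⟨-, -, hxc⟩ := mem_blankTilesSE.1 (hB (hmissed hb))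
      exact dots_subset_dots Set.Ioo_subset_Ioi_self (Set.Ici_subset_Ioi.2 (by omega))
    · obtain ⟨-, hxa, -⟩ := mem_blankTilesSE.1 (hB (hmet hb))
      exact dots_subset_dots (Set.Ici_subset_Ioi.2 (by omega)) Set.Ioo_subset_Ioi_self
  calc #C + #B = #C + #missed + #met := by
        rw [add_assoc, card_filter_add_card_filter_not]
    _ ≤ #C + #(missed.biUnion N) + #(met.biUnion S) := by
        gcongr
        · exact hw.card_le_card_biUnion_neDots (hmissed.trans hB)
            (hpath.mono (image_subset_image hmissed))
        · exact hw.card_le_card_biUnion_swDots (hmet.trans hB)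
            (hpath.mono (image_subset_image hmet))
    _ = #((C ∪ missed.biUnion N) ∪ met.biUnion S) := by
        rw [card_union_of_disjoint (disjoint_union_left.2 ⟨hCS, hNS⟩), card_union_of_disjoint hCN]
    _ ≤ #(seDots w x) := card_le_card hsub

end UpperBound

/-- The length of a longest increasing subsequence of `w` with positions in `S`. -/
noncomputable def lis (w : Equiv.Perm (Fin n)) (S : Finset (Fin n)) : ℕ :=
  maxCard (fun T : Finset (Fin n) => StrictMonoOn w (T : Set (Fin n))) S

section LowerBound

variable {x : Fin n} {a c s t : ℕ}

theorem card_neDots_le : #(neDots w x a c) ≤ a - (x + 1) := by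
  rw [← Nat.sub_sub, ← Nat.card_Ioo]
  exact card_le_card_of_injOn Fin.val (fun k hk => by simpa using (mem_dots.1 hk).1)
    Fin.val_injective.injOn

theorem card_swDots_le : #(swDots w x a c) ≤ c - (w x + 1) := by
  rw [swDots, ← card_dots_symm]
  exact card_neDots_le

theorem card_seDots_le (hxa : (x : ℕ) < a) (hxc : (w x : ℕ) < c)
    (hNW : StrictMonoOn w (dots w (Ioo x a) (Ioo (w x) c) : Set (Fin n))) (hSE : SEChain w a c) :
    #(seDots w x) ≤ lis w (seDots w x) + #(neDots w x a c) + #(swDots w x a c) := by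
  let C := dots w (Ioo x a) (Ioo (w x) c) ∪ dots w (Ici a) (Ici c)
  have hCx : C ⊆ seDots w x := union_subset
    (dots_subset_dots Set.Ioo_subset_Ioi_self Set.Ioo_subset_Ioi_self)
    (dots_subset_dots (Set.Ici_subset_Ioi.2 hxa) (Set.Ici_subset_Ioi.2 hxc))
  have hC : StrictMonoOn w (C : Set (Fin n)) := by
    intro k hk l hl hkl
    obtain hk | hk := mem_union.1 hk <;> obtain hl | hl := mem_union.1 hl
    · exact hNW hk hl hkl
    · simp only [mem_dots, Set.mem_Ioo, Set.mem_Ici] at hk hl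
      omega
    · simp only [mem_dots, Set.mem_Ioo, Set.mem_Ici] at hk hl
      omega
    · exact hSE hk hl hkl
  calc #(seDots w x) ≤ #(C ∪ neDots w x a c ∪ swDots w x a c) := card_le_card fun k => by
        simp only [C, seDots, neDots, swDots, mem_union, mem_dots, Set.mem_Ioi, Set.mem_Ioo,
          Set.mem_Ici]
        omega
    _ ≤ #C + #(neDots w x a c) + #(swDots w x a c) :=
        (card_union_le _ _).trans (Nat.add_le_add_right (card_union_le _ _) _)
    _ ≤ lis w (seDots w x) + #(neDots w x a c) + #(swDots w x a c) := by
        gcongr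
        exact card_le_maxCard hCx hC

theorem lt_of_not_seChain (h : ¬ SEChain w a c) : a < n ∧ c < n := by
  by_contra hnot
  exact h (seChain_of_le (by omega))

theorem IsVexillary.exists_nwChain_seChain {a c : ℕ} (hw : IsVexillary w) (h : NWChain w a c)
    (ha : a ≤ n) (hc : c ≤ n) :
    ∃ e, a + e ≤ n ∧ c + e ≤ n ∧ NWChain w (a + e) (c + e) ∧ SEChain w (a + e) (c + e) := by
  by_cases hSE : SEChain w a c
  · exact ⟨0, ha, hc, h, hSE⟩
  · obtain ⟨han, hcn⟩ := lt_of_not_seChain hSE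
    obtain ⟨e, he⟩ := IsVexillary.exists_nwChain_seChain hw
      ((hw.nwChain_succ_or_seChain a c).resolve_right hSE) han hcn
    simp only [add_assoc, add_comm 1 e] at he
    exact ⟨e + 1, he⟩
termination_by n - a

theorem diag_corner : diag (corner w x) = diag ((x : ℕ) + 1, (w x : ℕ) + 1) := by
  have hfst := corner_fst_add_label w x
  have hsnd := corner_snd_add_label w x
  simp only [diag]
  omega

theorem IsVexillary.exists_nwChain_lt_neCount (hw : IsVexillary w) (hNW : NWChain w a c)
    (ha : a ≤ n) (hc : c ≤ n) (hxa : (x : ℕ) < a) (hxc : (w x : ℕ) < c)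
    (hd : diag ((corner w x).1 + s, (corner w x).2 + t) = diag (a, c))
    (h : s + t + lis w (seDots w x) < #(seDots w x)) :
    ∃ e, a + e ≤ n ∧ c + e ≤ n ∧ NWChain w (a + e) (c + e) ∧
      (corner w x).1 + s < neCount w (a + e) (c + e) := by
  obtain ⟨e, hae, hce, hNW, hSE⟩ := hw.exists_nwChain_seChain hNW ha hc
  have hxa : (x : ℕ) < a + e := by omega
  have hxc : (w x : ℕ) < c + e := by omega
  have hdots := card_seDots_le hxa hxc (StrictMonoOn.mono hNW <| coe_subset.2 <|
    dots_subset_dots Set.Ioo_subset_Iio_self Set.Ioo_subset_Iio_self) hSE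
  have hne := hNW.card_neDots hxa hxc
  have hsw := hNW.card_swDots hxa hxc
  have hne_label := neCount_add_label (w := w) (c := c + e) hae
  have hsw_label := swCount_add_label (w := w) (a := a + e) hce
  simp only [diag] at hd
  exact ⟨e, hae, hce, hNW, by omega⟩

theorem not_seChain_of_add_lis_lt (h : s + t + lis w (seDots w x) < #(seDots w x)) :
    ¬ SEChain w (x + 1 + (s - t)) (w x + 1 + (t - s)) := by
  intro hSE
  have hNW : StrictMonoOn w
      (dots w (Ioo x (x + 1 + (s - t))) (Ioo (w x) (w x + 1 + (t - s))) : Set (Fin n)) :=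
    fun k hk => by
      simp only [mem_coe, mem_dots, Set.mem_Ioo] at hk
      omega
  have hdots := card_seDots_le (by omega) (by omega) hNW hSE
  have hne : #(neDots w x (x + 1 + (s - t)) (w x + 1 + (t - s))) ≤ s - t :=
    card_neDots_le.trans (by omega)
  have hsw : #(swDots w x (x + 1 + (s - t)) (w x + 1 + (t - s))) ≤ t - s :=
    card_swDots_le.trans (by omega)
  omega

theorem IsVexillary.mem_shapeSE (hw : IsVexillary w)
    (h : s + t + lis w (seDots w x) < #(seDots w x)) :
    ((corner w x).1 + s, (corner w x).2 + t) ∈ shapeSE w x := by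
  -- The vertex nearest to the dot, to the southeast, on the diagonal of the square.
  let a := x + 1 + (s - t)
  let c := w x + 1 + (t - s)
  have hxa : (x : ℕ) < a := by omega
  have hxc : (w x : ℕ) < c := by omega
  have hne : #(neDots w x a c) ≤ s - t := card_neDots_le.trans (by omega)
  have hnotSE : ¬ SEChain w a c := not_seChain_of_add_lis_lt h
  obtain ⟨ha, hc⟩ := lt_of_not_seChain hnotSE
  have hNW : NWChain w a c :=
    ((hw.nwChain_succ_or_seChain a c).resolve_right hnotSE).mono a.le_succ c.le_succ
  have hd : diag ((corner w x).1 + s, (corner w x).2 + t) = diag (a, c) := by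
    have := diag_corner (w := w) (x := x)
    simp only [diag] at this ⊢
    omega
  obtain ⟨e, hae, hce, hNWe, hlt⟩ := hw.exists_nwChain_lt_neCount hNW ha.le hc.le hxa hxc hd h
  have hde : diag (a + e, c + e) = diag (a, c) := by
    simp only [diag]
    omega
  obtain ⟨b, hb, hbp⟩ := mem_image.1 (hNWe.mem_image_slide hae hce (hd.trans hde.symm) hlt)
  have hdb : diag b = diag (a, c) := by rw [← hd, ← hbp, diag_slide]
  have hab : a ≤ b.1 := by
    by_contra! hba
    have hslide := slide_fst_lt_slide_fst hb hdb hba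
    rw [hbp, hNW.slide_blankTiles ha.le hc.le, ← hNW.card_neDots hxa hxc] at hslide
    dsimp only at hslide
    omega
  refine mem_image.2 ⟨b, mem_blankTilesSE.2 ⟨hb, by omega, ?_⟩, hbp⟩
  simp only [diag] at hdb
  omega

end LowerBound

/-! ### The codes -/

section Codes

variable {x : Fin n}

theorem exists_strictMonoOn_card_eq_lis (w : Equiv.Perm (Fin n)) (S : Finset (Fin n)) :
    ∃ C ⊆ S, StrictMonoOn w (C : Set (Fin n)) ∧ #C = lis w S :=
  exists_card_eq_maxCard (P := fun C : Finset (Fin n) => StrictMonoOn w (C : Set (Fin n)))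
    (by simp [StrictMonoOn]) S

theorem IsVexillary.lis_add_rhoA (hw : IsVexillary w) (x : Fin n) :
    lis w (seDots w x) + rhoA (shapeSE w x) = #(seDots w x) := by
  refine le_antisymm ?_ ?_
  · obtain ⟨C, hCx, hC, hCcard⟩ := exists_strictMonoOn_card_eq_lis w (seDots w x)
    obtain ⟨T, hTx, hT, hTcard⟩ := exists_card_eq_maxCard isAntidiagonalPath_empty (shapeSE w x)
    obtain ⟨B, hBx, rfl⟩ := subset_image_iff.1 hTx
    rw [card_image_of_injOn ((slide_injOn _).mono (hBx.trans (coe_subset.2 blankTilesSE_subset)))]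
      at hTcard
    rw [rhoA_eq_maxCard, ← hCcard, ← hTcard]
    exact hw.card_add_card_le hCx hC (coe_subset.1 hBx) hT
  · rw [← tsub_le_iff_left]
    exact le_rhoA_of_forall_mem (o := corner w x) fun s t hst => hw.mem_shapeSE (by omega)

theorem mem_seDots {k : Fin n} : k ∈ seDots w x ↔ x < k ∧ w x < w k := by simp [seDots]

theorem lehmer_add_card_seDots (w : Equiv.Perm (Fin n)) (x : Fin n) :
    lehmer w x + #(seDots w x) = #(Finset.Ioi x) := by
  have hsplit : {k ∈ Finset.Ioi x | w k < w x} = ({k | x < k ∧ w k < w x} : Finset (Fin n)) := by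
    ext k
    simp
  have hsplit' : {k ∈ Finset.Ioi x | ¬ w k < w x} = seDots w x := by
    ext k
    have : w k = w x ↔ k = x := w.injective.eq_iff
    rw [mem_filter, Finset.mem_Ioi, mem_seDots]
    omega
  rw [lehmer, ← hsplit, ← hsplit', card_filter_add_card_filter_not]

theorem strictMonoOn_Ici_sdiff_iff {R : Finset (Fin n)} (hR : R ⊆ Finset.Ioi x) :
    StrictMonoOn w (↑(Finset.Ici x \ R) : Set (Fin n)) ↔
      Finset.Ioi x \ R ⊆ seDots w x ∧ StrictMonoOn w (↑(Finset.Ioi x \ R) : Set (Fin n)) := by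
  have hxR : x ∉ R := fun hx => lt_irrefl x (Finset.mem_Ioi.1 (hR hx))
  have hgt : ∀ k ∈ (↑(Finset.Ioi x \ R) : Set (Fin n)), x < k := fun k hk =>
    Finset.mem_Ioi.1 (mem_sdiff.1 (mem_coe.1 hk)).1
  rw [← Finset.Ioi_insert, insert_sdiff_of_notMem _ hxR, coe_insert,
    strictMonoOn_insert_iff_of_forall_ge fun k hk => (hgt k hk).le]
  refine and_congr_left fun _ => forall₂_congr fun k hk => ?_
  rw [mem_seDots, imp_iff_right (hgt k hk), and_iff_right (hgt k hk)]

theorem rajchgot_add_lis (w : Equiv.Perm (Fin n)) (x : Fin n) :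
    rajchgot w x + lis w (seDots w x) = #(Finset.Ioi x) := by
  refine le_antisymm ?_ ?_
  · obtain ⟨C, hCx, hC, hcard⟩ := exists_strictMonoOn_card_eq_lis w (seDots w x)
    have hCI : C ⊆ Finset.Ioi x := fun k hk => Finset.mem_Ioi.2 (mem_seDots.1 (hCx hk)).1
    rw [← card_sdiff_add_card_eq_card hCI, ← hcard]
    gcongr
    refine Nat.sInf_le ⟨_, sdiff_subset, rfl, (strictMonoOn_Ici_sdiff_iff sdiff_subset).2 ?_⟩
    rw [Finset.sdiff_sdiff_eq_self hCI]
    exact ⟨hCx, hC⟩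
  · have hne : {m : ℕ | ∃ R : Finset (Fin n), R ⊆ Finset.Ioi x ∧ #R = m ∧
        StrictMonoOn w (↑(Finset.Ici x \ R) : Set (Fin n))}.Nonempty :=
      ⟨_, _, subset_rfl, rfl, (strictMonoOn_Ici_sdiff_iff subset_rfl).2 (by simp [StrictMonoOn])⟩
    obtain ⟨R, hR, hcard, hmono⟩ := Nat.sInf_mem hne
    obtain ⟨hsub, hmono⟩ := (strictMonoOn_Ici_sdiff_iff hR).1 hmono
    rw [← card_sdiff_add_card_eq_card hR, hcard, add_comm]
    exact Nat.add_le_add_left (card_le_maxCard hsub hmono) _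

theorem IsVexillary.rajchgot_eq (hw : IsVexillary w) (x : Fin n) :
    rajchgot w x = lehmer w x + rhoA (shapeSE w x) := by
  have := hw.lis_add_rhoA x
  have := lehmer_add_card_seDots w x
  have := rajchgot_add_lis w x
  omega

end Codes

/-! ### Decomposition by rank -/

section Rank

variable {x y : Fin n} {a c k : ℕ} {p q : ℕ × ℕ}

theorem NWChain.pipeRank_eq (h : NWChain w (x + 1) (w x + 1)) :
    pipeRank w (w x) = label w ((x : ℕ) + 1, (w x : ℕ) + 1) := by
  have hdots : ({k | k ≤ w.symm (w x) ∧ w k ≤ w x} : Finset (Fin n)) =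
      dots w (Iio (x + 1)) (Iio (w x + 1)) := by
    ext k
    simp
  have hlis : lis w (dots w (Iio (x + 1)) (Iio (w x + 1))) =
      #(dots w (Iio (x + 1)) (Iio (w x + 1))) := maxCard_eq_card h
  rw [label_eq_card_dots, ← hlis, ← hdots, pipeRank, lis, maxCard]
  congr!

theorem label_lt_label (hxy : x < y) (hw : w x < w y) :
    label w ((x : ℕ) + 1, (w x : ℕ) + 1) < label w ((y : ℕ) + 1, (w y : ℕ) + 1) := by
  rw [label_succ_fst y, if_pos (Nat.lt_succ_self _), Nat.lt_succ_iff]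
  exact label_mono hxy (Nat.succ_le_succ hw.le)

theorem NWChain.exists_label_eq (h : NWChain w a c) (hk : k < label w (a, c)) :
    ∃ x : Fin n, (x : ℕ) < a ∧ (w x : ℕ) < c ∧ label w ((x : ℕ) + 1, (w x : ℕ) + 1) = k + 1 := by
  rw [label_eq_card_dots] at hk
  obtain ⟨x, hx, rfl⟩ := exists_card_filter_lt_eq _ Function.injective_id.injOn hk
  obtain ⟨hxa, hxc⟩ := mem_dots.1 hx
  refine ⟨x, hxa, hxc, ?_⟩
  rw [label_succ_fst, if_pos (Nat.lt_succ_self _), label_eq_card_dots]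
  congr 2
  ext k
  have hmono : k ∈ dots w (Iio a) (Iio c) → k < x → w k < w x := fun hk hkx => h hk hx hkx
  have : k = x ↔ w k = w x := w.injective.eq_iff.symm
  simp only [mem_filter, mem_dots, Set.mem_Iio, id] at hxa hxc hmono ⊢
  omega

theorem IsVexillary.nwChain_of_mem_blankTilesSE (hw : IsVexillary w) (hp : p ∈ blankTilesSE w x) :
    NWChain w (x + 1) (w x + 1) := by
  obtain ⟨hp, hx, hwx⟩ := mem_blankTilesSE.1 hp
  exact (hw.nwChain_of_mem_blankTiles hp).mono (by omega) (by omega)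

theorem IsVexillary.nwChain_of_mem_shapeSE (hw : IsVexillary w) (hp : p ∈ shapeSE w x) :
    NWChain w (x + 1) (w x + 1) := by
  obtain ⟨b, hb, -⟩ := mem_image.1 hp
  exact hw.nwChain_of_mem_blankTilesSE hb

theorem IsVexillary.tau_eq_biUnion (hw : IsVexillary w) {lam : YoungDiagram} (h : IsShape w lam)
    (hk : 1 ≤ k) :
    tau w lam k = ({x | pipeRank w (w x) = k} : Finset (Fin n)).biUnion (shapeSE w) := by
  suffices hblank : {b ∈ blankTiles w | k ≤ label w b} =
      ({x | pipeRank w (w x) = k} : Finset (Fin n)).biUnion (blankTilesSE w) by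
    rw [tau_eq h, hblank, biUnion_image]
    rfl
  ext b
  simp only [mem_filter, mem_biUnion, mem_univ, true_and]
  constructor
  · rintro ⟨hb, hkb⟩
    obtain ⟨x, hxb, hwxb, hx⟩ :=
      ((hw.nwChain_of_mem_blankTiles hb).mono b.1.le_succ b.2.le_succ).exists_label_eq
        (Nat.sub_one_lt_of_le hk hkb)
    have hbx : b ∈ blankTilesSE w x := mem_blankTilesSE.2 ⟨hb, hxb, hwxb⟩
    rw [Nat.sub_add_cancel hk, ← (hw.nwChain_of_mem_blankTilesSE hbx).pipeRank_eq] at hx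
    exact ⟨x, hx, hbx⟩
  · rintro ⟨x, rfl, hbx⟩
    obtain ⟨hb, hxb, hwxb⟩ := mem_blankTilesSE.1 hbx
    rw [(hw.nwChain_of_mem_blankTilesSE hbx).pipeRank_eq]
    exact ⟨hb, label_mono hxb hwxb⟩

theorem IsVexillary.strictlyNE_of_mem_shapeSE (hw : IsVexillary w) (hxy : x < y)
    (hrank : pipeRank w (w x) = pipeRank w (w y)) (hp : p ∈ shapeSE w x) (hq : q ∈ shapeSE w y) :
    StrictlyNE p q := by
  rw [(hw.nwChain_of_mem_shapeSE hp).pipeRank_eq, (hw.nwChain_of_mem_shapeSE hq).pipeRank_eq]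
    at hrank
  have hyx : w y < w x := by
    refine lt_of_not_ge fun hle => ?_
    exact (label_lt_label hxy (hle.lt_of_ne (w.injective.ne hxy.ne))).ne hrank
  obtain ⟨b, hbx, rfl⟩ := mem_image.1 hp
  obtain ⟨d, hdy, rfl⟩ := mem_image.1 hq
  obtain ⟨hb, hxb, hwxb⟩ := mem_blankTilesSE.1 hbx
  obtain ⟨hd, hyd, hwyd⟩ := mem_blankTilesSE.1 hdy
  have hnot (v : ℕ × ℕ) (hv : v ∈ blankTiles w) : (y : ℕ) ≤ v.1 → ¬ (w x : ℕ) ≤ v.2 :=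
    fun hyv hxv => (hw.nwChain_of_mem_blankTiles hv (by simp; omega) (by simp; omega)
      hxy).not_gt hyx
  have hby : b.1 < y := lt_of_not_ge fun hyb => hnot b hb hyb hwxb.le
  have hdx : d.2 < w x := lt_of_not_ge fun hxd => hnot d hd hyd.le hxd
  constructor
  · have hslide := hw.slide_fst_add_label hb
    have hcorner := corner_fst_add_label w y
    have hlabel : label w (x + 1, w x + 1) ≤ label w b := label_mono hxb hwxb
    have hle := (hw.corner_le_slide hdy).1
    omega
  · have hslide := hw.slide_snd_add_label hd
    have hcorner := corner_snd_add_label w x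
    have hlabel : label w (y + 1, w y + 1) ≤ label w d := label_mono hyd hwyd
    have hle := (hw.corner_le_slide hbx).2
    omega

theorem IsVexillary.pairwise_shapeSE (hw : IsVexillary w) (k : ℕ) :
    (({x | pipeRank w (w x) = k} : Finset (Fin n)) : Set (Fin n)).Pairwise fun x y =>
      ∀ p ∈ shapeSE w x, ∀ q ∈ shapeSE w y, StrictlyNE q p ∨ StrictlyNE p q := by
  intro x hx y hy hne p hp q hq
  simp only [coe_filter, mem_univ, true_and, Set.mem_ofPred_eq] at hx hy
  obtain hxy | hyx := hne.lt_or_gt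
  · exact Or.inr (hw.strictlyNE_of_mem_shapeSE hxy (hx.trans hy.symm) hp hq)
  · exact Or.inl (hw.strictlyNE_of_mem_shapeSE hyx (hy.trans hx.symm) hq hp)

end Rank

end Vexillary

theorem mainTheorem2 (n : ℕ) (w : Equiv.Perm (Fin n)) (hw : Vexillary.IsVexillary w) :
    (∃! lam : YoungDiagram, Vexillary.IsShape w lam) ∧
    ∀ lam : YoungDiagram, Vexillary.IsShape w lam →
      ∀ k : ℕ, 1 ≤ k →
        (∑ i : Fin n with Vexillary.pipeRank w i = k,
          ((Vexillary.rajchgot w (w.symm i) : ℤ) - (Vexillary.lehmer w (w.symm i) : ℤ))) =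
        (Vexillary.rhoA (Vexillary.tau w lam k) : ℤ) := by
  refine ⟨hw.existsUnique_isShape, fun lam hlam k hk => ?_⟩
  calc ∑ i with Vexillary.pipeRank w i = k,
        ((Vexillary.rajchgot w (w.symm i) : ℤ) - Vexillary.lehmer w (w.symm i))
      = ∑ x with Vexillary.pipeRank w (w x) = k,
          ((Vexillary.rajchgot w x : ℤ) - Vexillary.lehmer w x) := by
        rw [Finset.sum_filter, Finset.sum_filter, ← Equiv.sum_comp w]
        simp only [Equiv.symm_apply_apply]
    _ = ∑ x with Vexillary.pipeRank w (w x) = k, (Vexillary.rhoA (Vexillary.shapeSE w x) : ℤ) :=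
        Finset.sum_congr rfl fun x _ => by
          rw [hw.rajchgot_eq, Nat.cast_add, add_sub_cancel_left]
    _ = Vexillary.rhoA (Vexillary.tau w lam k) := by
        rw [hw.tau_eq_biUnion hlam hk, Vexillary.rhoA_biUnion _ _ (hw.pairwise_shapeSE k),
          Nat.cast_sum]
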